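/- All rings are commutative with $1$. For a ring $R$, a finitely generated ideal $J$ is a *GV-ideal* if the natural map $R\to\operatorname{Hom}_R(J,R)$, $r\mapsto(x\mapsto rx)$, is an isomorphism. An $R$-module $M$ is *GV-torsion* if every element of $M$ is annihilated by some GV-ideal, and *GV-torsion-free* if $0$ is the only element of $M$ annihilated by some GV-ideal. A *$w$-module* is a GV-torsion-free module $M$ with $\operatorname{Ext}^1_R(R/J,M)=0$ for every GV-ideal $J$. A *maximal $w$-ideal* is an ideal maximal among the proper ideals of $R$ that are $w$-modules; such ideals are prime. A homomorphism $f$ is a *$w$-monomorphism* if $f_{\mathfrak p}$ is injective for every maximal $w$-ideal $\mathfrak p$, and $M$ is *$w$-flat* if $1_M\otimes f$ is a $w$-monomorphism for every $w$-monomorphism $f$. The ring $R$ is a *$w$-IF-ring* if every injective $w$-module is $w$-flat. An $R$-module $M$ is *copure projective* (resp. *$w$-copure projective*) if $\operatorname{Ext}^1_R(M,N)$ is zero (resp. GV-torsion) for every flat $R$-module $N$, and *strongly copure projective* (resp. *strongly $w$-copure projective*) if $\operatorname{Ext}^i_R(M,N)$ is zero (resp. GV-torsion) for every flat $R$-module $N$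 and every $i\ge 1$. An $R$-module $A$ is *absolutely $w$-pure* if $\operatorname{Ext}^1_R(N,A)$ is GV-torsion for every finitely presented $R$-module $N$. **Proposition.** Let $R$ be a coherent domain (an integral domain in which every finitely generated ideal is finitely presented). The following conditions are equivalent: 1. $R$ is a $w$-IF-ring; 2. every finitely presented $R$-module is copure projective; 3. every finitely presented $R$-module is strongly copure projective; 4. every finitely presented $R$-module is $w$-copure projective; 5. every finitely presented $R$-module is strongly $w$-copure projective; 6. $R$, as an $R$-module, is absolutely $w$-pure. -/

import Mathlib

open CategoryTheory

universe u

namespace WCopure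

section Definitions

variable (R : Type u) [CommRing R]

/-- A commutative ring is coherent if every finitely generated ideal is finitely presented. -/
def IsCoherentRing : Prop :=
  ∀ I : Ideal R, I.FG → Module.FinitePresentation R I

variable {R} in
/-- The natural homomorphism `R → Hom_R(J, R)`, sending `r` to multiplication by `r`. -/
def dualMap (J : Ideal R) : R →ₗ[R] (J →ₗ[R] R) :=
  LinearMap.toSpanSingleton R (J →ₗ[R] R) J.subtype

variable {R} in
/-- Glaz-Vasconcelos ideals: finitely generated, with `R → Hom_R(J, R)` an isomorphism. -/
structure IsGVIdeal (J : Ideal R) : Prop where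
  fg : J.FG
  bijective_dualMap : Function.Bijective (dualMap J)

/-- The set `tor_GV(M)` of elements of `M` killed by some GV-ideal. -/
def gvTor (M : Type u) [AddCommGroup M] [Module R M] : Set M :=
  {x | ∃ J : Ideal R, IsGVIdeal J ∧ ∀ a ∈ J, a • x = 0}

/-- `M` is GV-torsion if `tor_GV(M) = M`. -/
def IsGVTorsion (M : Type u) [AddCommGroup M] [Module R M] : Prop :=
  gvTor R M = Set.univ

/-- `M` is GV-torsion-free if `tor_GV(M) = 0`. -/
def IsGVTorsionFree (M : Type u) [AddCommGroup M] [Module R M] : Prop :=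
  gvTor R M = {0}

/-- The `R`-module `Ext^n_R(M, N)`. -/
abbrev ExtMod (M N : Type u) [AddCommGroup M] [Module R M] [AddCommGroup N] [Module R N]
    (n : ℕ) : Type u :=
  Abelian.Ext (ModuleCat.of R M) (ModuleCat.of R N) n

/-- A `w`-module: GV-torsion-free, and `Ext^1_R(R/J, M) = 0` for all GV-ideals `J`. -/
structure IsWModule (M : Type u) [AddCommGroup M] [Module R M] : Prop where
  torsionFree : IsGVTorsionFree R M
  ext_eq_zero : ∀ J : Ideal R, IsGVIdeal J → Subsingleton (ExtMod R (R ⧸ J) M 1)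

variable {R} in
/-- A maximal `w`-ideal: maximal among the proper ideals of `R` that are `w`-modules. -/
def IsMaximalWIdeal (p : Ideal R) : Prop :=
  Maximal (fun I : Ideal R => IsWModule R I ∧ I ≠ ⊤) p

variable {R} in
/-- `f` is a `w`-monomorphism if its localization at every maximal `w`-ideal `p` is injective.
Maximal `w`-ideals are always prime; the binder `[p.IsPrime]` only serves to form the
localization. -/
def IsWMono {A B : Type u} [AddCommGroup A] [Module R A] [AddCommGroup B] [Module R B]
    (f : A →ₗ[R] B) : Prop :=
  ∀ (p : Ideal R) [p.IsPrime], IsMaximalWIdeal p →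
    Function.Injective (LocalizedModule.map p.primeCompl f)

/-- `M` is `w`-flat if `M ⊗ -` preserves `w`-monomorphisms. -/
def IsWFlat (M : Type u) [AddCommGroup M] [Module R M] : Prop :=
  ∀ (A B : Type u) [AddCommGroup A] [Module R A] [AddCommGroup B] [Module R B]
    (f : A →ₗ[R] B), IsWMono f → IsWMono (f.lTensor M)

/-- `R` is a `w`-IF-ring if every injective `w`-module is `w`-flat. -/
def IsWIFRing : Prop :=
  ∀ (E : Type u) [AddCommGroup E] [Module R E],
    Module.Injective R E → IsWModule R E → IsWFlat R E

/-- `Ext^1_R(M, N) = 0` for every flat module `N`. -/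
def IsCopureProjective (M : Type u) [AddCommGroup M] [Module R M] : Prop :=
  ∀ (N : Type u) [AddCommGroup N] [Module R N], Module.Flat R N →
    Subsingleton (ExtMod R M N 1)

/-- `Ext^i_R(M, N) = 0` for every flat module `N` and every `i ≥ 1`. -/
def IsStronglyCopureProjective (M : Type u) [AddCommGroup M] [Module R M] : Prop :=
  ∀ (N : Type u) [AddCommGroup N] [Module R N], Module.Flat R N →
    ∀ i : ℕ, 1 ≤ i → Subsingleton (ExtMod R M N i)

/-- `Ext^1_R(M, N)` is GV-torsion for every flat module `N`. -/
def IsWCopureProjective (M : Type u) [AddCommGroup M] [Module R M] : Prop :=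
  ∀ (N : Type u) [AddCommGroup N] [Module R N], Module.Flat R N →
    IsGVTorsion R (ExtMod R M N 1)

/-- `Ext^i_R(M, N)` is GV-torsion for every flat module `N` and every `i ≥ 1`. -/
def IsStronglyWCopureProjective (M : Type u) [AddCommGroup M] [Module R M] : Prop :=
  ∀ (N : Type u) [AddCommGroup N] [Module R N], Module.Flat R N →
    ∀ i : ℕ, 1 ≤ i → IsGVTorsion R (ExtMod R M N i)

/-- `A` is absolutely `w`-pure if `Ext^1_R(N, A)` is GV-torsion for every finitely presented
module `N`. -/
def IsAbsolutelyWPure (A : Type u) [AddCommGroup A] [Module R A] : Prop :=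
  ∀ (N : Type u) [AddCommGroup N] [Module R N], Module.FinitePresentation R N →
    IsGVTorsion R (ExtMod R N A 1)

end Definitions

end WCopure

/-! Each condition forces the domain `R` to be a field, and over a field every module is projective
and flat. Otherwise take a nonzero nonunit `a`. The ideal `(a)` is a proper `w`-ideal, so it
contains no GV-ideal (`isWModule_span_singleton`, `IsGVIdeal.not_le`). The class of `1` in
`Ext^1(R/(a), R) ≅ R/(a)` has annihilator `(a)`, hence is not GV-torsion. Moreover `(a)` lies in a
maximal `w`-ideal `p`, and the characters of `R_p` form an injective `w`-module. Tensoring it with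
the injective map `a : R → R` kills `c ⊗ 1` for some nonzero character `c` with `a • c = 0`, and `c
⊗ 1` survives localization at `p`, so this module is not `w`-flat. -/

namespace WCopure

open Abelian

/-! ### Ext¹ of cyclic modules -/

section Ext

variable {R : Type u} [CommRing R]

/-- The short exact sequence `0 → I → R → R ⧸ I → 0`. -/
abbrev idealShortComplex (I : Ideal R) : ShortComplex (ModuleCat.{u} R) :=
  ShortComplex.mk (ModuleCat.ofHom I.subtype) (ModuleCat.ofHom I.mkQ) (by
    ext x
    exact (Submodule.Quotient.mk_eq_zero I).mpr x.2)

lemma idealShortComplex_shortExact (I : Ideal R) : (idealShortComplex I).ShortExact where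
  exact := by
    rw [ShortComplex.ShortExact.moduleCat_exact_iff_function_exact]
    exact LinearMap.exact_subtype_mkQ I
  mono_f := (ModuleCat.mono_iff_injective _).mpr I.injective_subtype
  epi_g := (ModuleCat.epi_iff_surjective _).mpr I.mkQ_surjective

/-- If every homomorphism `I → M` is multiplication by an element of `M`, then
`Ext^1_R(R ⧸ I, M) = 0`. -/
lemma subsingleton_ext_one_quotient (I : Ideal R) (M : Type u) [AddCommGroup M] [Module R M]
    (h : ∀ f : I →ₗ[R] M, ∃ m : M, ∀ x : I, f x = (x : R) • m) :
    Subsingleton (ExtMod R (R ⧸ I) M 1) := by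
  refine subsingleton_of_forall_eq 0 fun e => ?_
  have hS := idealShortComplex_shortExact I
  obtain ⟨y, rfl⟩ := Ext.contravariant_sequence_exact₃ hS (ModuleCat.of R M) e
    (Ext.eq_zero_of_projective _) (n₀ := 0) rfl
  obtain ⟨φ, rfl⟩ := Ext.mk₀_bijective _ _ |>.2 y
  obtain ⟨m, hm⟩ := h φ.hom
  have hφ : φ = (idealShortComplex I).f ≫ ModuleCat.ofHom (LinearMap.toSpanSingleton R M m) := by
    ext x
    exact hm x
  rw [hφ, ← Ext.mk₀_comp_mk₀, hS.extClass_comp_assoc]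

/-- The image `e` of `f` under the connecting homomorphism `Hom_R(I, M) → Ext^1_R(R ⧸ I, M)`:
if `r` kills `e`, then `r • f` is multiplication by an element of `M`. -/
lemma exists_ext_one_quotient (I : Ideal R) {M : Type u} [AddCommGroup M] [Module R M]
    (f : I →ₗ[R] M) :
    ∃ e : ExtMod R (R ⧸ I) M 1, ∀ r : R, r • e = 0 → ∃ m : M, ∀ x : I, r • f x = (x : R) • m := by
  have hS := idealShortComplex_shortExact I
  let φ : (idealShortComplex I).X₁ ⟶ ModuleCat.of R M := ModuleCat.ofHom f
  refine ⟨hS.extClass.comp (Ext.mk₀ φ) rfl, fun r hr => ?_⟩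
  have h0 : hS.extClass.comp (Ext.mk₀ (r • φ)) rfl = 0 := by
    rw [Ext.mk₀_smul, Ext.comp_smul]
    exact hr
  obtain ⟨y, hy⟩ := Ext.contravariant_sequence_exact₁ hS (ModuleCat.of R M) _ rfl h0
  obtain ⟨ψ, rfl⟩ := Ext.mk₀_bijective _ _ |>.2 y
  rw [Ext.mk₀_comp_mk₀] at hy
  have hψ := (Ext.mk₀_bijective _ _).1 hy
  refine ⟨ψ.hom (1 : R), fun x => ?_⟩
  have hx : ψ.hom (x : R) = r • f x := congrArg (fun g => g.hom x) hψ
  rw [← hx, ← map_smul, smul_eq_mul, mul_one]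

end Ext

/-! ### GV-ideals and ideals that are `w`-modules -/

section GVIdeal

variable {R : Type u} [CommRing R]

lemma isGVIdeal_top : IsGVIdeal (⊤ : Ideal R) where
  fg := ⟨{1}, by simp⟩
  bijective_dualMap := by
    refine ⟨fun r s h => ?_, fun f => ⟨f ⟨1, trivial⟩, ?_⟩⟩
    · simpa [dualMap] using LinearMap.congr_fun h ⟨1, trivial⟩
    · ext x
      have hx : x = (x : R) • (⟨1, trivial⟩ : (⊤ : Ideal R)) := by ext; simp
      conv_rhs => rw [hx, map_smul]
      simp [dualMap, mul_comm]

lemma isGVTorsion_of_subsingleton (M : Type u) [AddCommGroup M] [Module R M] [Subsingleton M] :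
    IsGVTorsion R M :=
  Set.eq_univ_of_forall fun _ => ⟨⊤, isGVIdeal_top, fun _ _ => Subsingleton.elim _ _⟩

/-- Homomorphisms from a GV-ideal to the ring are multiplications. -/
lemma IsGVIdeal.exists_eq_mul {J : Ideal R} (hJ : IsGVIdeal J) (f : J →ₗ[R] R) :
    ∃ r : R, ∀ x : J, f x = x * r := by
  obtain ⟨r, rfl⟩ := hJ.bijective_dualMap.2 f
  exact ⟨r, fun x => by simp [dualMap, mul_comm]⟩

/-- A GV-ideal is faithful. -/
lemma IsGVIdeal.eq_of_mul_eq {J : Ideal R} (hJ : IsGVIdeal J) {r s : R}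
    (h : ∀ x ∈ J, x * r = x * s) : r = s := by
  refine hJ.bijective_dualMap.1 (LinearMap.ext fun x => ?_)
  simpa [dualMap, mul_comm] using h x x.2

lemma isGVTorsionFree_iff (M : Type u) [AddCommGroup M] [Module R M] :
    IsGVTorsionFree R M ↔
      ∀ (J : Ideal R) (x : M), IsGVIdeal J → (∀ a ∈ J, a • x = 0) → x = 0 := by
  refine ⟨fun h J x hJ hx => ?_, fun h => ?_⟩
  · have hmem : x ∈ gvTor R M := ⟨J, hJ, hx⟩
    rwa [h] at hmem
  · ext x
    refine ⟨fun ⟨J, hJ, hx⟩ => h J x hJ hx, ?_⟩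
    rintro rfl
    exact ⟨⊤, isGVIdeal_top, fun _ _ => smul_zero _⟩

/-- An ideal is a `w`-module if and only if it contains every ring element some GV-multiple of
which it contains. -/
lemma isWModule_ideal_iff (I : Ideal R) :
    IsWModule R I ↔ ∀ (J : Ideal R) (x : R), IsGVIdeal J → (∀ a ∈ J, a * x ∈ I) → x ∈ I := by
  refine ⟨fun h J x hJ hx => ?_, fun h => ⟨?_, fun J hJ => ?_⟩⟩
  · have := h.ext_eq_zero J hJ
    let f : J →ₗ[R] I :=
      ((LinearMap.toSpanSingleton R R x).comp J.subtype).codRestrict I fun a => hx a a.2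
    obtain ⟨e, he⟩ := exists_ext_one_quotient J f
    -- Ext vanishes, so already `r = 1` kills the class, and `a ↦ a * x` is multiplication by some
    -- `m ∈ I`.
    obtain ⟨m, hm⟩ := he 1 (Subsingleton.elim _ _)
    have hxm : x = m := hJ.eq_of_mul_eq fun a ha => by
      have hma := congrArg Subtype.val (hm ⟨a, ha⟩)
      rwa [one_smul] at hma
    exact hxm ▸ m.2
  · rw [isGVTorsionFree_iff]
    intro J x hJ hx
    refine Subtype.ext (hJ.eq_of_mul_eq fun a ha => ?_)
    simpa using congrArg Subtype.val (hx a ha)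
  · refine subsingleton_ext_one_quotient J I fun f => ?_
    obtain ⟨r, hr⟩ := hJ.exists_eq_mul (I.subtype.comp f)
    exact ⟨⟨r, h J r hJ fun a ha => hr ⟨a, ha⟩ ▸ (f ⟨a, ha⟩).2⟩, fun x => Subtype.ext (hr x)⟩

end GVIdeal

/-! ### Maximal `w`-ideals -/

section MaximalWIdeal

variable {R : Type u} [CommRing R]

lemma IsMaximalWIdeal.isPrime {p : Ideal R} (hp : IsMaximalWIdeal p) : p.IsPrime := by
  have hw := (isWModule_ideal_iff p).mp hp.prop.1
  refine ⟨hp.prop.2, fun {x y} hxy => or_iff_not_imp_left.mpr fun hx => ?_⟩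
  -- The colon ideal `(p : x)` is a proper `w`-ideal containing `p`, so maximality puts it inside
  -- `p`.
  let q : Ideal R := Submodule.comap (LinearMap.toSpanSingleton R R x) p
  have hq : ∀ r, r ∈ q ↔ r * x ∈ p := fun r => Iff.rfl
  have hqw : IsWModule R q := (isWModule_ideal_iff q).mpr fun J r hJ hr => by
    rw [hq]
    exact hw J _ hJ fun a ha => by simpa [hq, mul_assoc] using hr a ha
  have hqt : q ≠ ⊤ := fun h => hx (by
    have h1 : (1 : R) ∈ q := h ▸ Submodule.mem_top
    simpa [hq] using h1)
  exact hp.le_of_ge ⟨hqw, hqt⟩ (fun r hr => (hq r).mpr (p.mul_mem_right x hr))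
    ((hq y).mpr (mul_comm x y ▸ hxy))

/-- A GV-ideal is not contained in any proper `w`-ideal. -/
lemma IsGVIdeal.not_le {J p : Ideal R} (hJ : IsGVIdeal J) (hp : IsWModule R p) (hpt : p ≠ ⊤) :
    ¬ J ≤ p := fun h =>
  hpt ((Ideal.eq_top_iff_one p).mpr ((isWModule_ideal_iff p).mp hp J 1 hJ fun a ha => by
    simpa using h ha))

/-- A principal ideal generated by a nonzerodivisor is a `w`-ideal. -/
lemma isWModule_span_singleton {a : R} (ha : a ∈ nonZeroDivisors R) :
    IsWModule R (Ideal.span {a}) := by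
  refine (isWModule_ideal_iff _).mpr fun J x hJ hx => ?_
  choose g hg using fun b : J => Ideal.mem_span_singleton'.mp (hx b b.2)
  have hinj : ∀ {r s : R}, r * a = s * a → r = s := fun h =>
    (mul_cancel_right_mem_nonZeroDivisors ha).mp h
  -- Division of `b * x` by `a`.
  let f : J →ₗ[R] R :=
    { toFun := g
      map_add' := fun b c => hinj (by
        rw [add_mul, hg, hg, hg, Submodule.coe_add, add_mul])
      map_smul' := fun r b => hinj (by
        rw [RingHom.id_apply, smul_eq_mul, mul_assoc, hg, hg, Submodule.coe_smul, smul_eq_mul,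
          mul_assoc]) }
  obtain ⟨r, hr⟩ := hJ.exists_eq_mul f
  refine Ideal.mem_span_singleton'.mpr ⟨r, hJ.eq_of_mul_eq fun b hb => ?_⟩
  rw [← hg ⟨b, hb⟩, show g ⟨b, hb⟩ = b * r from hr ⟨b, hb⟩, mul_assoc]

/-- Every proper `w`-ideal is contained in a maximal `w`-ideal. -/
lemma exists_le_isMaximalWIdeal {I : Ideal R} (hI : IsWModule R I) (hIt : I ≠ ⊤) :
    ∃ p : Ideal R, I ≤ p ∧ IsMaximalWIdeal p := by
  refine zorn_le_nonempty₀ {I : Ideal R | IsWModule R I ∧ I ≠ ⊤} ?_ I ⟨hI, hIt⟩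
  intro c hc hchain K hK
  have hne : c.Nonempty := ⟨K, hK⟩
  have hdir : DirectedOn (· ≤ ·) c := hchain.directedOn
  refine ⟨sSup c, ⟨(isWModule_ideal_iff _).mpr fun J x hJ hx => ?_, fun h => ?_⟩,
    fun _ => le_sSup⟩
  -- `J * x` is finitely generated, so it already lies in one member of the chain.
  · have hle : Submodule.map (LinearMap.toSpanSingleton R R x) J ≤ sSup c := by
      rintro _ ⟨a, ha, rfl⟩
      exact hx a ha
    obtain ⟨L, hL, hJL⟩ := (Submodule.fg_iff_compact _).mp
      (Submodule.FG.map (LinearMap.toSpanSingleton R R x) hJ.fg) c _ hne hdir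
      (isLUB_sSup c) hle
    exact le_sSup hL ((isWModule_ideal_iff L).mp (hc hL).1 J x hJ fun a ha =>
      hJL ⟨a, ha, rfl⟩)
  · obtain ⟨L, hL, h1⟩ := (Submodule.mem_sSup_of_directed hne hdir).mp
      ((Ideal.eq_top_iff_one _).mp h)
    exact (hc hL).2 ((Ideal.eq_top_iff_one L).mpr h1)

end MaximalWIdeal

/-! ### Character modules of localizations -/

section Injective

variable {R : Type u} [CommRing R]

/-- A GV-torsion-free injective module is a `w`-module. -/
lemma isWModule_of_injective (E : Type u) [AddCommGroup E] [Module R E]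
    (hE : Module.Injective R E) (h : IsGVTorsionFree R E) : IsWModule R E where
  torsionFree := h
  ext_eq_zero J _ := subsingleton_ext_one_quotient J E fun f => by
    obtain ⟨g, hg⟩ := hE.out J.subtype J.injective_subtype f
    exact ⟨g 1, fun x => by rw [← hg x, ← map_smul]; simp⟩

lemma injective_characterModule_atPrime (p : Ideal R) [p.IsPrime] :
    Module.Injective R (CharacterModule (Localization.AtPrime p)) :=
  Module.Flat.iff_characterModule_injective.mp (IsLocalization.flat _ p.primeCompl)

/-- Elements outside `p` act invertibly on `R_p`, hence on its characters. -/
lemma characterModule_atPrime_eq_zero (p : Ideal R) [p.IsPrime] {s : R} (hs : s ∉ p)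
    {c : CharacterModule (Localization.AtPrime p)} (h : s • c = 0) : c = 0 := by
  ext y
  obtain ⟨u, hu⟩ := IsLocalization.map_units (Localization.AtPrime p) (⟨s, hs⟩ : p.primeCompl)
  have hy : y = s • (↑u⁻¹ * y) := by
    rw [Algebra.smul_def, ← mul_assoc, ← show (u : Localization.AtPrime p) = _ from hu,
      Units.mul_inv, one_mul]
  rw [hy]
  exact DFunLike.congr_fun h (↑u⁻¹ * y)

/-- The character module of the localization at a prime `w`-ideal is a `w`-module. -/
lemma isWModule_characterModule_atPrime (p : Ideal R) [p.IsPrime] (hp : IsWModule R p) :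
    IsWModule R (CharacterModule (Localization.AtPrime p)) := by
  refine isWModule_of_injective _ (injective_characterModule_atPrime p) ?_
  rw [isGVTorsionFree_iff]
  intro J c hJ hc
  obtain ⟨s, hsJ, hsp⟩ := SetLike.not_le_iff_exists.mp (hJ.not_le hp Ideal.IsPrime.ne_top')
  exact characterModule_atPrime_eq_zero p hsp (hc s hsJ)

end Injective

/-! ### Conditions that force a field -/

section Field

variable {R : Type u} [CommRing R] [IsDomain R]

/-- If `a` is a nonzero nonunit of the domain `R` and `p` is a maximal `w`-ideal containing `a`,
then the character module of `R_p` is an injective `w`-module with `a`-torsion that survives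
localization at `p`, hence it is not `w`-flat. -/
lemma isField_of_isWIFRing (h : IsWIFRing R) : IsField R := by
  by_contra hR
  obtain ⟨a, ha0, hau⟩ := Ring.exists_not_isUnit_of_not_isField hR
  obtain ⟨p, hap, hp⟩ := exists_le_isMaximalWIdeal
    (isWModule_span_singleton (mem_nonZeroDivisors_of_ne_zero ha0))
    (mt Ideal.span_singleton_eq_top.mp hau)
  have := hp.isPrime
  have hap : a ∈ p := hap (Ideal.mem_span_singleton_self a)
  let S := Localization.AtPrime p
  -- As `a ∈ p` is not a unit in `R_p`, the class of `1` modulo `a` is nonzero, so some character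
  -- detects it.
  obtain ⟨d, hd⟩ : ∃ d : CharacterModule (S ⧸ Ideal.span {algebraMap R S a}),
      d (Ideal.Quotient.mk _ 1) ≠ 0 := by
    refine CharacterModule.exists_character_apply_ne_zero_of_ne_zero fun h1 => ?_
    rw [Ideal.Quotient.eq_zero_iff_mem, ← Ideal.eq_top_iff_one, Ideal.span_singleton_eq_top,
      IsLocalization.AtPrime.isUnit_to_map_iff S p] at h1
    exact h1 hap
  let c : CharacterModule S := d.comp (Ideal.Quotient.mk _).toAddMonoidHom
  have hac : a • c = 0 := by
    ext y
    change d (Ideal.Quotient.mk _ (a • y)) = 0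
    rw [Ideal.Quotient.eq_zero_iff_mem.mpr, map_zero]
    rw [Algebra.smul_def]
    exact Ideal.mul_mem_right _ _ (Ideal.mem_span_singleton_self _)
  let f : R →ₗ[R] R := LinearMap.mulLeft R a
  have hf : IsWMono f := fun q _ _ =>
    IsLocalizedModule.map_injective q.primeCompl (LocalizedModule.mkLinearMap _ _)
      (LocalizedModule.mkLinearMap _ _) f (mul_right_injective₀ ha0)
  have hflat := h _ (injective_characterModule_atPrime p)
    (isWModule_characterModule_atPrime p hp.prop.1) _ _ f hf p hp
  have hzero : LocalizedModule.mk (c ⊗ₜ[R] (1 : R)) (1 : p.primeCompl) = 0 := by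
    refine hflat ?_
    rw [map_zero, LocalizedModule.map_mk, LinearMap.lTensor_tmul,
      show f 1 = a • (1 : R) by simp [f], ← TensorProduct.smul_tmul, hac,
      TensorProduct.zero_tmul, LocalizedModule.zero_mk]
  obtain ⟨s, hs⟩ := LocalizedModule.mk_eq.mp (hzero.trans (LocalizedModule.zero_mk 1).symm)
  have hsc : (s : R) • c = 0 := by
    have hs' : ((s : R) • c) ⊗ₜ[R] (1 : R) = 0 := by
      rwa [smul_zero, smul_zero, one_smul] at hs
    simpa using congrArg (TensorProduct.rid R (CharacterModule S)) hs'
  exact hd (DFunLike.congr_fun (characterModule_atPrime_eq_zero p s.2 hsc) (1 : S))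

/-- For `a ≠ 0` in a domain, `Ext^1_R(R ⧸ (a), R) ≅ R ⧸ (a)` is GV-torsion only if `a` is a
unit. -/
lemma isField_of_isAbsolutelyWPure (h : IsAbsolutelyWPure R R) : IsField R := by
  by_contra hR
  obtain ⟨a, ha0, hau⟩ := Ring.exists_not_isUnit_of_not_isField hR
  have hfp : Module.FinitePresentation R (R ⧸ Ideal.span {a}) :=
    Module.finitePresentation_of_surjective (Ideal.span {a}).mkQ (Submodule.mkQ_surjective _)
      (by rw [Submodule.ker_mkQ]; exact ⟨{a}, by simp⟩)
  -- The connecting map applied to `φ.symm`, division by `a`, gives the class `e`. If `r` kills `e`,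
  -- evaluating at `a = φ 1` yields `r = a * m`.
  let φ := LinearEquiv.toSpanNonzeroSingleton R R a ha0
  obtain ⟨e, he⟩ := exists_ext_one_quotient (Ideal.span {a}) φ.symm.toLinearMap
  have hmem : e ∈ gvTor R _ := (h _ hfp).symm ▸ Set.mem_univ e
  obtain ⟨J, hJ, hJe⟩ := hmem
  refine hJ.not_le (isWModule_span_singleton (mem_nonZeroDivisors_of_ne_zero ha0))
    (mt Ideal.span_singleton_eq_top.mp hau) fun r hr => ?_
  obtain ⟨m, hm⟩ := he r (hJe r hr)
  refine Ideal.mem_span_singleton.mpr ⟨m, ?_⟩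
  have hm1 : r • φ.symm (φ 1) = (φ 1 : R) • m := hm (φ 1)
  rwa [φ.symm_apply_apply, smul_eq_mul, smul_eq_mul, mul_one,
    LinearEquiv.toSpanNonzeroSingleton_one] at hm1

end Field

/-! ### The field case -/

section OfIsField

variable {R : Type u} [CommRing R]

lemma isWIFRing_of_isField (hR : IsField R) : IsWIFRing R := by
  let := hR.toField
  intro E _ _ _ _ A B _ _ _ _ f hf p _ hp
  -- Elements outside `p` are nonzero, hence units, so injectivity after localizing at `p` descends
  -- to `f`.
  have hinj : Function.Injective f := by
    refine (injective_iff_map_eq_zero f).mpr fun x hx => ?_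
    have h0 : LocalizedModule.mk x (1 : p.primeCompl) = 0 := by
      refine hf p hp ?_
      rw [map_zero, LocalizedModule.map_mk, hx, LocalizedModule.zero_mk]
    obtain ⟨s, hs⟩ := LocalizedModule.mk_eq.mp (h0.trans (LocalizedModule.zero_mk 1).symm)
    have hs0 : (s : R) ≠ 0 := fun h => s.2 (h ▸ p.zero_mem)
    exact (smul_eq_zero_iff_right hs0).mp (by
      rwa [smul_zero, smul_zero, one_smul] at hs)
  exact IsLocalizedModule.map_injective p.primeCompl (LocalizedModule.mkLinearMap _ _)
    (LocalizedModule.mkLinearMap _ _) _ (Module.Flat.lTensor_preserves_injective_linearMap f hinj)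

lemma isStronglyCopureProjective_of_isField (hR : IsField R) (M : Type u) [AddCommGroup M]
    [Module R M] : IsStronglyCopureProjective R M := by
  have hM : Module.Projective R M := by
    let := hR.toField
    infer_instance
  intro N _ _ _ i hi
  obtain ⟨n, rfl⟩ := Nat.exists_eq_add_of_le' hi
  exact subsingleton_of_forall_eq 0 Ext.eq_zero_of_projective

end OfIsField

end WCopure

/-- Over a domain, each of the six conditions says that the ring is a field: `w`-flat modules have
no torsion after localization at maximal `w`-ideals, and `Ext^1_R(R ⧸ (a), R) ≅ R ⧸ (a)` is
GV-torsion-free for `a ≠ 0`. -/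
theorem proposition3p3 (R : Type u) [CommRing R] [IsDomain R]
    (hR : WCopure.IsCoherentRing R) :
    List.TFAE [
      WCopure.IsWIFRing R,
      ∀ (M : Type u) [AddCommGroup M] [Module R M], Module.FinitePresentation R M →
        WCopure.IsCopureProjective R M,
      ∀ (M : Type u) [AddCommGroup M] [Module R M], Module.FinitePresentation R M →
        WCopure.IsStronglyCopureProjective R M,
      ∀ (M : Type u) [AddCommGroup M] [Module R M], Module.FinitePresentation R M →
        WCopure.IsWCopureProjective R M,
      ∀ (M : Type u) [AddCommGroup M] [Module R M], Module.FinitePresentation R M →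
        WCopure.IsStronglyWCopureProjective R M,
      WCopure.IsAbsolutelyWPure R R] := by
  tfae_have 1 → 3 := fun h M _ _ _ =>
    WCopure.isStronglyCopureProjective_of_isField (WCopure.isField_of_isWIFRing h) M
  tfae_have 3 → 2 := fun h M _ _ hM N _ _ hN => h M hM N hN 1 le_rfl
  tfae_have 3 → 5 := fun h M _ _ hM N _ _ hN i hi =>
    have := h M hM N hN i hi
    WCopure.isGVTorsion_of_subsingleton _
  tfae_have 2 → 4 := fun h M _ _ hM N _ _ hN =>
    have := h M hM N hN
    WCopure.isGVTorsion_of_subsingleton _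
  tfae_have 5 → 4 := fun h M _ _ hM N _ _ hN => h M hM N hN 1 le_rfl
  tfae_have 4 → 6 := fun h N _ _ hN => h N hN R inferInstance
  tfae_have 6 → 1 := fun h =>
    WCopure.isWIFRing_of_isField (WCopure.isField_of_isAbsolutelyWPure h)
  tfae_finish
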